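/- Let $\mathbb H$ be the quaternions, with $\mathbb C=\mathbb R+\mathbb R\boldsymbol i\subset\mathbb H$, and let $\mathcal H_q$ be a separable right quaternionic Hilbert space, with inner product satisfying $\langle xp,y\rangle=\langle x,y\rangle p$ and $\overline{\langle x,y\rangle}=\langle y,x\rangle$. Let $n\ge 1$ and let $\Omega_q\subset\mathbb H$ be open, connected and non-empty, with $\Omega_q\cap\mathbb R=\emptyset$. For a bounded right linear operator $T$ on $\mathcal H_q$ and $\omega\in\mathbb H$ put $Q_\omega(T)=T^2-2\,\mathrm{Re}(\omega)T+|\omega|^2I$. The class $B_n^s(\Omega_q)$ consists of the bounded right linear operators $T$ such that, for all $\omega\in\Omega_q$, $Q_\omega(T)$ is not invertible, $\mathrm{ran}\,Q_\omega(T)=\mathcal H_q$ and $\dim_{\mathbb H}\ker Q_\omega(T)=n$, and such that the closed right linear span of $\bigcup_{\omega\in\Omega_q}\ker Q_\omega(T)$ is $\mathcal H_q$. Let $\Omega_{red}=\{\mathrm{Re}(\omega)+\boldsymbol i|\mathrm{Im}(\omega)|:\omega\in\Omega_q\}\subset\mathbb C$, and let $E_T=\{(x,\omega):\omega\in\Omega_{red},\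 x\in\ker Q_\omega(T)\}$. A map $\gamma$ from an open set $\Delta\subseteq\mathbb C$ to $\mathcal H_q$ is right holomorphic if $\gamma'(z)=\lim_{h\to0,\,h\in\mathbb C}(\gamma(z+h)-\gamma(z))h^{-1}$ exists for every $z\in\Delta$; $\gamma^{(m)}$ denotes its $m$-th derivative in this sense. A right holomorphic cross-section of $E_T$ over an open set $\Delta\subseteq\Omega_{red}$ is a right holomorphic map $\gamma:\Delta\to\mathcal H_q$ with $\gamma(\omega)\in\ker Q_\omega(T)$ for all $\omega\in\Delta$. Let $T_1,T_2\in B_n^s(\Omega_q)$. Then each $E_{T_i}$ is an $n$-dimensional Hermitian right holomorphic quaternionic vector bundle over $\Omega_{red}$, i.e. every point of $\Omega_{red}$ has an open neighbourhood $\Delta\subseteq\Omega_{red}$ with right holomorphic maps $\gamma_1,\dots,\gamma_n:\Delta\to\mathcal H_q$ such that $\gamma_1(\omega),\dots,\gamma_n(\omega)$ is a basis of $\ker Q_\omega(T_i)$ for every $\omega\in\Delta$. Moreover, $T_1$ and $T_2$ are quaternion unitarily equivalent (there is a bounded right linear $U$ on $\mathcal H_q$ with $U^*U=UU^*=I$ and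 $UT_1=T_2U$) if and only if $E_{T_1}$ and $E_{T_2}$ are equivalent as Hermitian right holomorphic quaternionic vector bundles, that is, there is a bundle map $\Phi:E_{T_1}\to E_{T_2}$ over the identity of $\Omega_{red}$ such that 1. for every $\omega\in\Omega_{red}$, $\Phi$ restricts to a right linear isomorphism $\ker Q_\omega(T_1)\to\ker Q_\omega(T_2)$; 2. for every right holomorphic cross-section $\gamma$ of $E_{T_1}$ over an open subset of $\Omega_{red}$, $\Phi(\gamma)$ is a right holomorphic cross-section of $E_{T_2}$; 3. for any two right holomorphic cross-sections $\gamma,\widetilde\gamma$ of $E_{T_1}$ over the same open subset of $\Omega_{red}$ and every integer $m\ge0$, $\langle\gamma^{(m)},\widetilde\gamma\rangle=\langle(\Phi(\gamma))^{(m)},\Phi(\widetilde\gamma)\rangle$ at every point of that subset. -/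

import Mathlib

open Filter Topology
open scoped Quaternion RightActions

noncomputable section

/-- A quaternionic inner product on a right quaternionic vector space `H`, inducing the norm of `H`.
The right action `x · p` of a quaternion `p` is written `x <• p`. Conjugate linearity in the second
variable follows from conjugate symmetry, and positive definiteness is contained in `qinner_self`.
A quaternionic Hilbert space is such an `H` which is complete. -/
class QuaternionicInnerProductSpace (H : Type*) [NormedAddCommGroup H] [Module ℍᵐᵒᵖ H] where
  qinner : H → H → ℍ
  star_qinner : ∀ x y : H, star (qinner y x) = qinner x y
  qinner_add_left : ∀ x y z : H, qinner (x + y) z = qinner x z + qinner y z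
  qinner_smul_left : ∀ (x z : H) (p : ℍ), qinner (x <• p) z = qinner x z * p
  qinner_self : ∀ x : H, qinner x x = ((‖x‖ ^ 2 : ℝ) : ℍ)

namespace QuaternionicHilbert

open QuaternionicInnerProductSpace

variable {H : Type*} [NormedAddCommGroup H] [Module ℍᵐᵒᵖ H] [QuaternionicInnerProductSpace H]

theorem norm_rightSMul (x : H) (p : ℍ) : ‖x <• p‖ = ‖p‖ * ‖x‖ := by
  have h1 : qinner (x <• p) (x <• p) = star p * qinner x x * p := by
    rw [qinner_smul_left, ← star_qinner x (x <• p), qinner_smul_left, star_mul,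
      star_qinner]
  rw [qinner_self, qinner_self, mul_assoc, Quaternion.coe_mul_eq_smul, mul_smul_comm,
    Quaternion.star_mul_self, Quaternion.normSq_eq_norm_mul_self, Quaternion.smul_coe] at h1
  have h2 : ‖x <• p‖ ^ 2 = (‖p‖ * ‖x‖) ^ 2 := by
    rw [Quaternion.coe_injective h1]; ring
  exact (sq_eq_sq₀ (norm_nonneg _) (by positivity)).1 h2

/-- Multiplication by a real number, as a bounded right linear operator. -/
def realSMul (H : Type*) [NormedAddCommGroup H] [Module ℍᵐᵒᵖ H]
    [QuaternionicInnerProductSpace H] (r : ℝ) : H →L[ℍᵐᵒᵖ] H where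
  toFun x := x <• (r : ℍ)
  map_add' x y := smul_add _ x y
  map_smul' q x := by
    obtain ⟨p, rfl⟩ := MulOpposite.op_surjective q
    simp only [RingHom.id_apply, smul_smul, ← MulOpposite.op_mul, Quaternion.coe_commutes]
  cont := by
    refine (AddMonoidHomClass.lipschitz_of_bound
      (DistribSMul.toAddMonoidHom H (MulOpposite.op (r : ℍ))) ‖(r : ℍ)‖ fun x => ?_).continuous
    exact (norm_rightSMul x (r : ℍ)).le

/-- The operator `T² - 2 Re(s) T + |s|² I`. -/
def sPoly (T : H →L[ℍᵐᵒᵖ] H) (s : ℍ) : H →L[ℍᵐᵒᵖ] H :=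
  T ^ 2 - realSMul H (2 * s.re) * T + realSMul H (‖s‖ ^ 2)

/-- The `S`-spectrum. -/
def sSpectrum (T : H →L[ℍᵐᵒᵖ] H) : Set ℍ := {s | ¬ IsUnit (sPoly T s)}

/-- The kernel of `T² - 2 Re(s) T + |s|² I`, a right quaternionic subspace. -/
def sKer (T : H →L[ℍᵐᵒᵖ] H) (s : ℍ) : Submodule ℍᵐᵒᵖ H :=
  LinearMap.ker (sPoly T s : H →ₗ[ℍᵐᵒᵖ] H)

/-- The quaternionic Cowen–Douglas class `B_n^s(Ω_q)`. -/
structure IsCowenDouglas (n : ℕ) (Ωq : Set ℍ) (T : H →L[ℍᵐᵒᵖ] H) : Prop where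
  subset_sSpectrum : Ωq ⊆ sSpectrum T
  range_eq : ∀ ω ∈ Ωq, Set.range (sPoly T ω) = Set.univ
  dense_span : closure (Submodule.span ℍᵐᵒᵖ (⋃ ω ∈ Ωq, (sKer T ω : Set H)) : Set H) = Set.univ
  rank_eq : ∀ ω ∈ Ωq, Module.rank ℍᵐᵒᵖ (sKer T ω) = n

/-- The axially symmetric reduced set `Ω_red = {Re ω + i |Im ω| : ω ∈ Ω_q}`. -/
def reducedSet (Ωq : Set ℍ) : Set ℂ := (fun ω : ℍ => (⟨ω.re, ‖ω.im‖⟩ : ℂ)) '' Ωq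

/-- `S` is the adjoint of `Q`. -/
def IsAdjoint (Q S : H →L[ℍᵐᵒᵖ] H) : Prop := ∀ x y : H, qinner (Q x) y = qinner x (S y)

/-- `Q` is a quaternionic unitary operator: `Q* Q = Q Q* = I`. -/
def IsQuaternionicUnitary (Q : H →L[ℍᵐᵒᵖ] H) : Prop :=
  ∃ S : H →L[ℍᵐᵒᵖ] H, IsAdjoint Q S ∧ S * Q = 1 ∧ Q * S = 1

/-- Quaternion unitary equivalence of bounded right linear operators. -/
def UnitarilyEquivalent (T₁ T₂ : H →L[ℍᵐᵒᵖ] H) : Prop :=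
  ∃ Q : H →L[ℍᵐᵒᵖ] H, IsQuaternionicUnitary Q ∧ Q * T₁ = T₂ * Q

/-- `f` has right derivative `f'` at `z`: `(f(z + h) - f(z)) h⁻¹ → f'` as `h → 0` in `ℂ`,
where `ℂ = ℝ + ℝ i ⊆ ℍ` acts on the right. -/
def HasRightDerivAt (f : ℂ → H) (f' : H) (z : ℂ) : Prop :=
  Tendsto (fun h : ℂ => (f (z + h) - f z) <• ((h : ℍ)⁻¹)) (𝓝[≠] 0) (𝓝 f')

/-- `f` is right holomorphic on the (open) set `Δ`. -/
def RightHolomorphicOn (f : ℂ → H) (Δ : Set ℂ) : Prop :=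
  ∀ z ∈ Δ, ∃ f' : H, HasRightDerivAt f f' z

open Classical in
/-- The right derivative (`0` where it does not exist). -/
def rightDeriv (f : ℂ → H) (z : ℂ) : H :=
  if h : ∃ f' : H, HasRightDerivAt f f' z then h.choose else 0

/-- The `m`-th right derivative `f^{(m)}`. -/
def iteratedRightDeriv (m : ℕ) (f : ℂ → H) : ℂ → H := rightDeriv^[m] f

/-- `γ` is a right holomorphic cross-section over `Δ` of the family `t` of subspaces. -/
structure IsRightHolomorphicSection (t : ℂ → Submodule ℍᵐᵒᵖ H) (Δ : Set ℂ) (γ : ℂ → H) :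
    Prop where
  holomorphic : RightHolomorphicOn γ Δ
  mem : ∀ ω ∈ Δ, γ ω ∈ t ω

/-- `t` is, on `Ω`, a right holomorphic curve of `n`-dimensional subspaces; equivalently, the family
`E_t = {(x, ω) : ω ∈ Ω, x ∈ t ω}` is an `n`-dimensional Hermitian right holomorphic quaternionic
vector bundle: it has local right holomorphic frames. -/
def IsRightHolomorphicCurve (n : ℕ) (Ω : Set ℂ) (t : ℂ → Submodule ℍᵐᵒᵖ H) : Prop :=
  ∀ ω₀ ∈ Ω, ∃ Δ : Set ℂ, IsOpen Δ ∧ ω₀ ∈ Δ ∧ Δ ⊆ Ω ∧ ∃ γ : Fin n → ℂ → H,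
    (∀ i, RightHolomorphicOn (γ i) Δ) ∧
    ∀ ω ∈ Δ, LinearIndependent ℍᵐᵒᵖ (fun i => γ i ω) ∧
      Submodule.span ℍᵐᵒᵖ (Set.range fun i => γ i ω) = t ω

open Classical in
/-- The section `Φ(γ)`, for a family `Φ` of right linear isomorphisms between the fibres over `Ω`
(extended by `0` to the points where `γ` does not take its value in the fibre). -/
def mapSection {Ω : Set ℂ} {t₁ t₂ : ℂ → Submodule ℍᵐᵒᵖ H}
    (Φ : ∀ ω : Ω, t₁ ω ≃ₗ[ℍᵐᵒᵖ] t₂ ω) (γ : ℂ → H) (ω : ℂ) : H :=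
  if h : ∃ _ : ω ∈ Ω, γ ω ∈ t₁ ω then (Φ ⟨ω, h.1⟩ ⟨γ ω, h.2⟩ : H) else 0

/-- `E_{t₁}` and `E_{t₂}` are equivalent over `Ω` as Hermitian right holomorphic quaternionic vector
bundles. Cross-sections are taken over arbitrary open subsets `Δ` of `Ω`. -/
def BundleEquivalent (Ω : Set ℂ) (t₁ t₂ : ℂ → Submodule ℍᵐᵒᵖ H) : Prop :=
  ∃ Φ : ∀ ω : Ω, t₁ ω ≃ₗ[ℍᵐᵒᵖ] t₂ ω,
    (∀ (Δ : Set ℂ) (γ : ℂ → H), IsOpen Δ → Δ ⊆ Ω → IsRightHolomorphicSection t₁ Δ γ →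
      IsRightHolomorphicSection t₂ Δ (mapSection Φ γ)) ∧
    ∀ (Δ : Set ℂ) (γ γ' : ℂ → H), IsOpen Δ → Δ ⊆ Ω →
      IsRightHolomorphicSection t₁ Δ γ → IsRightHolomorphicSection t₁ Δ γ' →
      ∀ (m : ℕ), ∀ ω ∈ Δ,
        qinner (iteratedRightDeriv m γ ω) (γ' ω) =
          qinner (iteratedRightDeriv m (mapSection Φ γ) ω) (mapSection Φ γ' ω)

/-- The curve `t_T(ω) = ker (T² - 2 Re(ω) T + |ω|² I)`, `ω ∈ ℂ ⊆ ℍ`. -/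
def kernelCurve (T : H →L[ℍᵐᵒᵖ] H) (ω : ℂ) : Submodule ℍᵐᵒᵖ H := sKer T (ω : ℍ)

end QuaternionicHilbert

end

noncomputable section

namespace QuaternionicHilbert

open QuaternionicInnerProductSpace

/-! Restricting the right action to `ℂ` makes `H` a complex Hilbert space on which `T` is complex
linear and `Q_ω(T) = (T - ω)(T - ω̄)`. For non-real `ω`, `ker Q_ω(T) = V ⊕ V j` with `V = ker (T -
ω)`, so a complex basis of `V` is a quaternionic basis of the fibre. Surjectivity of `Q_ω(T)` passes
to `T - ω`, and the classical Cowen–Douglas construction then gives holomorphic frames of `V`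
(`exists_local_frame`).

A unitary intertwiner restricts to a bundle equivalence. The converse rests on two facts. Right
holomorphic sections of `ker Q_ω(T)` take values in `ker (T - ω)`
(`mem_eigenspace_of_differentiableAt`). Moreover `Φ` preserves inner products between vectors of
different fibres (`preservesInner_of_curve`): near a base point by Taylor expansion, then globally
by the identity theorem. Hence `Φ` extends to a unitary on the closed span of the fibres. It
intertwines `T₁` and `T₂` because a frame vector and its image are eigenvectors for the same `ω`. -/

/-- The opposite ring of the quaternions, as a normed division ring. -/
@[reducible] def normedDivisionRingOpposite : NormedDivisionRing ℍᵐᵒᵖ where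
  __ := (inferInstance : DivisionRing ℍᵐᵒᵖ)
  __ := (inferInstance : NormedRing ℍᵐᵒᵖ)
  norm_mul a b := by
    change ‖b.unop * a.unop‖ = ‖a.unop‖ * ‖b.unop‖
    rw [norm_mul, mul_comm]

/-! ### The quaternionic inner product and the underlying complex Hilbert space. -/

section Inner

variable {H : Type*} [NormedAddCommGroup H] [Module ℍᵐᵒᵖ H] [QuaternionicInnerProductSpace H]

theorem qinner_add_right (x y z : H) : qinner x (y + z) = qinner x y + qinner x z := by
  rw [← star_qinner, qinner_add_left, star_add, star_qinner, star_qinner]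

theorem qinner_smul_right (x y : H) (p : ℍ) : qinner x (y <• p) = star p * qinner x y := by
  rw [← star_qinner, qinner_smul_left, star_mul, star_qinner]

theorem qinner_zero_left (y : H) : qinner (0 : H) y = 0 := by
  simpa using qinner_smul_left (0 : H) y 0

/-- `x ↦ ⟨x, y⟩` as an additive map. -/
def qinnerLeft (y : H) : H →+ ℍ where
  toFun x := qinner x y
  map_zero' := qinner_zero_left y
  map_add' x z := qinner_add_left x z y

/-- `y ↦ ⟨x, y⟩` as an additive map. -/
def qinnerRight (x : H) : H →+ ℍ where
  toFun y := qinner x y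
  map_zero' := by rw [← star_qinner, qinner_zero_left, star_zero]
  map_add' y z := qinner_add_right x y z

theorem qinner_sum_left {ι : Type*} (s : Finset ι) (f : ι → H) (y : H) :
    qinner (∑ i ∈ s, f i) y = ∑ i ∈ s, qinner (f i) y :=
  map_sum (qinnerLeft y) f s

theorem qinner_sum_right {ι : Type*} (s : Finset ι) (x : H) (f : ι → H) :
    qinner x (∑ i ∈ s, f i) = ∑ i ∈ s, qinner x (f i) :=
  map_sum (qinnerRight x) f s

variable (H) in
theorem isBoundedSMul : IsBoundedSMul ℍᵐᵒᵖ H :=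
  .of_norm_smul_le fun q x => (norm_rightSMul x q.unop).le

/-- The component in `ℂ = ℝ + ℝ i` of a quaternion with respect to `ℍ = ℂ ⊕ j ℂ`. -/
def complexPart (q : ℍ) : ℂ := ⟨q.re, q.imI⟩

theorem norm_coeComplex (c : ℂ) : ‖(c : ℍ)‖ = ‖c‖ := by
  refine (sq_eq_sq₀ (norm_nonneg _) (norm_nonneg _)).1 ?_
  rw [sq, ← Quaternion.normSq_eq_norm_mul_self, Quaternion.normSq_def', Complex.sq_norm,
    Complex.normSq_apply]
  simp
  ring

/-- The right action of `ℂ ⊆ ℍ`, as a complex vector space structure. -/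
@[reducible] def complexModule : Module ℂ H :=
  Module.compHom H (RingHom.toOpposite (Quaternion.ofComplex : ℂ →+* ℍ) fun x y => by
    change ((x : ℍ) * y = y * x)
    rw [← Quaternion.coeComplex_mul, mul_comm, Quaternion.coeComplex_mul])

attribute [local instance] complexModule

/-- The complex Hilbert space underlying a quaternionic Hilbert space. -/
@[reducible] def complexInnerProductSpace : InnerProductSpace ℂ H where
  __ := (complexModule : Module ℂ H)
  norm_smul_le c x := by
    change ‖x <• (c : ℍ)‖ ≤ _
    rw [norm_rightSMul, norm_coeComplex]
  inner x y := complexPart (qinner y x)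
  norm_sq_eq_re_inner x := by
    rw [qinner_self]
    rfl
  conj_inner_symm x y := by
    rw [← star_qinner y x]
    apply Complex.ext <;> simp [complexPart]
  add_left x y z := by
    rw [qinner_add_right]
    apply Complex.ext <;> simp [complexPart]
  smul_left x y c := by
    change complexPart (qinner y (x <• (c : ℍ))) = _
    rw [qinner_smul_right]
    apply Complex.ext <;> simp [complexPart, Quaternion.re_mul, Quaternion.imI_mul]

end Inner

attribute [local instance] complexInnerProductSpace

/-! ### Complex linearization of the operators and the splitting of the fibres. -/

section Complex

variable {H : Type*} [NormedAddCommGroup H] [Module ℍᵐᵒᵖ H] [QuaternionicInnerProductSpace H]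

theorem complex_smul_eq (c : ℂ) (x : H) : c • x = x <• (c : ℍ) := rfl

theorem inner_eq_complexPart (x y : H) : inner ℂ x y = complexPart (qinner y x) := rfl

/-- The quaternion unit `j`. -/
def quatJ : ℍ := ⟨0, 0, 1, 0⟩

@[simp] theorem re_quatJ : quatJ.re = 0 := rfl
@[simp] theorem imI_quatJ : quatJ.imI = 0 := rfl
@[simp] theorem imJ_quatJ : quatJ.imJ = 1 := rfl
@[simp] theorem imK_quatJ : quatJ.imK = 0 := rfl

theorem eq_add_mul_quatJ (q : ℍ) :
    q = ((⟨q.re, q.imI⟩ : ℂ) : ℍ) + ((⟨q.imJ, q.imK⟩ : ℂ) : ℍ) * quatJ := by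
  ext <;> simp

theorem quatJ_mul_coeComplex (c : ℂ) :
    quatJ * (c : ℍ) = ((starRingEnd ℂ c : ℂ) : ℍ) * quatJ := by
  ext <;> simp

theorem quatJ_mul_quatJ : quatJ * quatJ = -1 := by
  ext <;> simp

/-- Since `star j * ⟨x, y⟩ = ⟨x, y j⟩`, this recovers a quaternionic inner product from the complex
ones against `y` and `y j`. -/
theorem eq_of_complexPart_eq {p q : ℍ} (h : complexPart p = complexPart q)
    (h' : complexPart (star quatJ * p) = complexPart (star quatJ * q)) : p = q := by
  simp only [complexPart, Complex.mk.injEq] at h h'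
  simp at h'
  ext <;> [exact h.1; exact h.2; exact h'.1; exact h'.2]

theorem smul_rightSMul_quatJ (c : ℂ) (x : H) :
    (c • x) <• quatJ = (starRingEnd ℂ c) • (x <• quatJ) := by
  rw [complex_smul_eq, complex_smul_eq, smul_smul, smul_smul, ← MulOpposite.op_mul,
    ← MulOpposite.op_mul, quatJ_mul_coeComplex, Complex.conj_conj]

theorem rightSMul_eq (x : H) (q : ℍ) :
    x <• q = (⟨q.re, q.imI⟩ : ℂ) • x + ((⟨q.imJ, q.imK⟩ : ℂ) • x) <• quatJ := by
  conv_lhs => rw [eq_add_mul_quatJ q]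
  rw [MulOpposite.op_add, add_smul, complex_smul_eq, complex_smul_eq, smul_smul,
    ← MulOpposite.op_mul]

/-- A right linear operator as a complex linear operator. -/
def toComplex (T : H →L[ℍᵐᵒᵖ] H) : H →L[ℂ] H where
  toFun := T
  map_add' := map_add T
  map_smul' _ x := map_smul T _ x
  cont := T.cont

@[simp] theorem toComplex_apply (T : H →L[ℍᵐᵒᵖ] H) (x : H) : toComplex T x = T x := rfl

theorem map_complex_smul (T : H →L[ℍᵐᵒᵖ] H) (c : ℂ) (x : H) : T (c • x) = c • T x :=
  map_smul T _ x

theorem sPoly_apply (T : H →L[ℍᵐᵒᵖ] H) (s : ℍ) (x : H) :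
    sPoly T s x = T (T x) - ((2 * s.re : ℝ) : ℂ) • T x + ((‖s‖ ^ 2 : ℝ) : ℂ) • x := by
  rw [complex_smul_eq, complex_smul_eq, Quaternion.coeComplex_coe, Quaternion.coeComplex_coe]
  rfl

theorem sPoly_eq_of_re_norm (T : H →L[ℍᵐᵒᵖ] H) {s t : ℍ} (h : s.re = t.re) (h' : ‖s‖ = ‖t‖) :
    sPoly T s = sPoly T t := by
  rw [sPoly, sPoly, h, h']

theorem hasRightDerivAt_iff {f : ℂ → H} {f' : H} {z : ℂ} :
    HasRightDerivAt f f' z ↔ HasDerivAt f f' z := by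
  rw [hasDerivAt_iff_tendsto_slope_zero, HasRightDerivAt]
  refine iff_of_eq ?_
  congr 1
  funext h
  rw [complex_smul_eq]
  have : ((h⁻¹ : ℂ) : ℍ) = ((h : ℍ))⁻¹ := map_inv₀ Quaternion.ofComplex h
  rw [this]

theorem rightDeriv_eq (f : ℂ → H) : rightDeriv f = deriv f := by
  funext z
  unfold rightDeriv
  split_ifs with h
  · exact (hasRightDerivAt_iff.1 h.choose_spec).deriv.symm
  · refine (deriv_zero_of_not_differentiableAt fun hd => h ⟨_, hasRightDerivAt_iff.2 hd.hasDerivAt⟩).symm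

theorem iteratedRightDeriv_eq (m : ℕ) (f : ℂ → H) : iteratedRightDeriv m f = iteratedDeriv m f := by
  rw [iteratedDeriv_eq_iterate, iteratedRightDeriv]
  congr 1
  funext f
  exact rightDeriv_eq f

theorem rightHolomorphicOn_iff {f : ℂ → H} {Δ : Set ℂ} (hΔ : IsOpen Δ) :
    RightHolomorphicOn f Δ ↔ DifferentiableOn ℂ f Δ := by
  refine ⟨fun h z hz => ?_, fun h z hz => ?_⟩
  · obtain ⟨f', hf⟩ := h z hz
    exact (hasRightDerivAt_iff.1 hf).differentiableAt.differentiableWithinAt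
  · exact ⟨_, hasRightDerivAt_iff.2 (h.differentiableAt (hΔ.mem_nhds hz)).hasDerivAt⟩

/-- The complex eigenspace `ker (T - ω)` of a right linear operator. -/
def eigenspace (T : H →L[ℍᵐᵒᵖ] H) (ω : ℂ) : Submodule ℂ H :=
  LinearMap.ker ((toComplex T - ω • ContinuousLinearMap.id ℂ H : H →L[ℂ] H) : H →ₗ[ℂ] H)

theorem mem_eigenspace {T : H →L[ℍᵐᵒᵖ] H} {ω : ℂ} {x : H} : x ∈ eigenspace T ω ↔ T x = ω • x := by
  simp [eigenspace, sub_eq_zero]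

theorem sPoly_coe_apply (T : H →L[ℍᵐᵒᵖ] H) (ω : ℂ) (x : H) :
    sPoly T (ω : ℍ) x = T (T x) - (ω + starRingEnd ℂ ω) • T x + (ω * starRingEnd ℂ ω) • x := by
  rw [sPoly_apply, norm_coeComplex, Quaternion.re_coeComplex, Complex.add_conj, Complex.mul_conj,
    Complex.normSq_eq_norm_sq]

theorem mem_kernelCurve {T : H →L[ℍᵐᵒᵖ] H} {ω : ℂ} {x : H} :
    x ∈ kernelCurve T ω ↔
      T (T x) - (ω + starRingEnd ℂ ω) • T x + (ω * starRingEnd ℂ ω) • x = 0 := by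
  rw [← sPoly_coe_apply]
  rfl

theorem eigenspace_le_kernelCurve {T : H →L[ℍᵐᵒᵖ] H} {ω : ℂ} {x : H} (hx : x ∈ eigenspace T ω) :
    x ∈ kernelCurve T ω := by
  rw [mem_eigenspace] at hx
  rw [mem_kernelCurve, hx, map_complex_smul, hx]
  module

theorem rightSMul_quatJ_mem_eigenspace {T : H →L[ℍᵐᵒᵖ] H} {ω : ℂ} {x : H}
    (hx : x ∈ eigenspace T ω) : x <• quatJ ∈ eigenspace T (starRingEnd ℂ ω) := by
  rw [mem_eigenspace] at hx ⊢
  rw [map_smul, hx, smul_rightSMul_quatJ]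

/-- Partial fractions for `(T - ω)(T - ω̄)`: as `ω ≠ ω̄`, `x` is the sum of an `ω`- and an
`ω̄`-eigenvector, and right multiplication by `j` exchanges the two eigenspaces. -/
theorem exists_eigenspace_decomposition {T : H →L[ℍᵐᵒᵖ] H} {ω : ℂ} (hω : ω.im ≠ 0) {x : H}
    (hx : x ∈ kernelCurve T ω) :
    ∃ u ∈ eigenspace T ω, ∃ v ∈ eigenspace T ω, x = u + v <• quatJ := by
  have hne : ω - starRingEnd ℂ ω ≠ 0 := by
    intro h
    apply hω
    have := congrArg Complex.im h
    simp at this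
    linarith
  rw [mem_kernelCurve] at hx
  have hTT : T (T x) = (ω + starRingEnd ℂ ω) • T x - (ω * starRingEnd ℂ ω) • x := by
    rw [← sub_eq_zero, ← hx]
    abel
  have hu : (ω - starRingEnd ℂ ω)⁻¹ • (T x - starRingEnd ℂ ω • x) ∈ eigenspace T ω := by
    rw [mem_eigenspace, map_complex_smul, map_sub, map_complex_smul, hTT]
    module
  have hw : -(ω - starRingEnd ℂ ω)⁻¹ • (T x - ω • x) ∈ eigenspace T (starRingEnd ℂ ω) := by
    rw [mem_eigenspace, map_complex_smul, map_sub, map_complex_smul, hTT]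
    module
  have hv := rightSMul_quatJ_mem_eigenspace hw
  rw [Complex.conj_conj] at hv
  refine ⟨_, hu, _, neg_mem hv, ?_⟩
  rw [smul_neg, smul_smul, ← MulOpposite.op_mul, quatJ_mul_quatJ, MulOpposite.op_neg, neg_smul,
    neg_neg, MulOpposite.op_one, one_smul]
  have h1 : (ω - starRingEnd ℂ ω)⁻¹ • ((ω - starRingEnd ℂ ω) • x) = x := inv_smul_smul₀ hne x
  conv_lhs => rw [← h1]
  module

end Complex

/-! ### Local holomorphic frames, and sections as eigenvectors. -/

section Frames

variable {H : Type*} [NormedAddCommGroup H] [Module ℍᵐᵒᵖ H] [QuaternionicInnerProductSpace H]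

theorem ne_conj_of_im_ne_zero {ω : ℂ} (hω : ω.im ≠ 0) : ω - starRingEnd ℂ ω ≠ 0 :=
  fun h => hω (Complex.conj_eq_iff_im.1 (sub_eq_zero.1 h).symm)

theorem rightSMul_quatJ_quatJ {H : Type*} [AddCommGroup H] [Module ℍᵐᵒᵖ H] (x : H) : (x <• quatJ) <• quatJ = -x := by
  rw [smul_smul, ← MulOpposite.op_mul, quatJ_mul_quatJ, MulOpposite.op_neg, neg_smul,
    MulOpposite.op_one, one_smul]

theorem eq_zero_of_add_rightSMul_quatJ_eq_zero {T : H →L[ℍᵐᵒᵖ] H} {ω : ℂ} (hω : ω.im ≠ 0)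
    {u v : H} (hu : u ∈ eigenspace T ω) (hv : v ∈ eigenspace T ω) (h : u + v <• quatJ = 0) :
    u = 0 ∧ v = 0 := by
  have hvj := mem_eigenspace.1 (rightSMul_quatJ_mem_eigenspace hv)
  have huv : v <• quatJ = -u := (neg_eq_of_add_eq_zero_right h).symm
  rw [huv, map_neg, mem_eigenspace.1 hu, smul_neg, neg_inj, ← sub_eq_zero, ← sub_smul] at hvj
  have hu0 : u = 0 := (smul_eq_zero.1 hvj).resolve_left (ne_conj_of_im_ne_zero hω)
  refine ⟨hu0, ?_⟩
  rw [← neg_eq_zero, ← rightSMul_quatJ_quatJ, huv, hu0, neg_zero, smul_zero]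

/-- Writing the coefficients as `a + b j` with `a, b ∈ ℂ` turns a quaternionic relation into `u + v
j = 0` with `u, v` in the eigenspace. Both vanish, being complex relations. -/
theorem linearIndependent_of_eigenspace {T : H →L[ℍᵐᵒᵖ] H} {ω : ℂ} (hω : ω.im ≠ 0)
    {ι : Type*} {e : ι → H} (he : LinearIndependent ℂ e) (hmem : ∀ i, e i ∈ eigenspace T ω) :
    LinearIndependent ℍᵐᵒᵖ e := by
  rw [linearIndependent_iff'] at he ⊢
  intro s g hg
  have hsum : ∑ i ∈ s, (⟨(g i).unop.re, (g i).unop.imI⟩ : ℂ) • e i +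
      (∑ i ∈ s, (⟨(g i).unop.imJ, (g i).unop.imK⟩ : ℂ) • e i) <• quatJ = 0 := by
    rw [Finset.smul_sum, ← Finset.sum_add_distrib, ← hg]
    exact Finset.sum_congr rfl fun i _ => (rightSMul_eq (e i) (g i).unop).symm
  obtain ⟨hu, hv⟩ := eq_zero_of_add_rightSMul_quatJ_eq_zero (T := T) hω
    (sum_mem fun i _ => Submodule.smul_mem _ _ (hmem i))
    (sum_mem fun i _ => Submodule.smul_mem _ _ (hmem i)) hsum
  intro i hi
  have h1 := he s _ hu i hi
  have h2 := he s _ hv i hi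
  rw [Complex.ext_iff] at h1 h2
  refine MulOpposite.unop_injective ?_
  ext <;> [exact h1.1; exact h1.2; exact h2.1; exact h2.2]

theorem span_eq_kernelCurve {T : H →L[ℍᵐᵒᵖ] H} {ω : ℂ} (hω : ω.im ≠ 0)
    {ι : Type*} {e : ι → H} (he : Submodule.span ℂ (Set.range e) = eigenspace T ω) :
    Submodule.span ℍᵐᵒᵖ (Set.range e) = kernelCurve T ω := by
  have hle : ∀ x ∈ eigenspace T ω, x ∈ Submodule.span ℍᵐᵒᵖ (Set.range e) := by
    intro x hx
    rw [← he] at hx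
    induction hx using Submodule.span_induction with
    | mem x h => exact Submodule.subset_span h
    | zero => exact zero_mem _
    | add x y _ _ hx hy => exact add_mem hx hy
    | smul c x _ hx => exact Submodule.smul_mem _ (MulOpposite.op (c : ℍ)) hx
  refine le_antisymm (Submodule.span_le.2 ?_) fun x hx => ?_
  · rintro _ ⟨i, rfl⟩
    exact eigenspace_le_kernelCurve (he ▸ Submodule.subset_span ⟨i, rfl⟩)
  · obtain ⟨u, hu, v, hv, rfl⟩ := exists_eigenspace_decomposition hω hx
    exact add_mem (hle u hu) (Submodule.smul_mem _ _ (hle v hv))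

theorem exists_eigenspace_basis {T : H →L[ℍᵐᵒᵖ] H} {ω : ℂ} (hω : ω.im ≠ 0) {n : ℕ}
    (hn : Module.rank ℍᵐᵒᵖ (kernelCurve T ω) = n) :
    ∃ e : Fin n → H, LinearIndependent ℂ e ∧ Submodule.span ℂ (Set.range e) = eigenspace T ω := by
  -- The index type is not yet known to be finite; its cardinality is read off from the quaternionic
  -- rank.
  let b := Module.Basis.ofVectorSpace ℂ (eigenspace T ω)
  let e := fun i => (b i : H)
  have hli : LinearIndependent ℂ e :=
    b.linearIndependent.map' (eigenspace T ω).subtype (Submodule.ker_subtype _)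
  have hspan : Submodule.span ℂ (Set.range e) = eigenspace T ω := by
    have : Set.range e = (eigenspace T ω).subtype '' Set.range b := by
      rw [← Set.range_comp]
      rfl
    rw [this, ← Submodule.map_span, b.span_eq, Submodule.map_subtype_top]
  have hcard := rank_span (linearIndependent_of_eigenspace hω hli fun i => (b i).2)
  rw [span_eq_kernelCurve hω hspan, hn, Cardinal.mk_range_eq _ hli.injective] at hcard
  obtain ⟨f⟩ := Cardinal.mk_eq_nat_iff.1 hcard.symm
  refine ⟨e ∘ f.symm, hli.comp _ f.symm.injective, ?_⟩
  rw [f.symm.surjective.range_comp, hspan]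

/-- `A` is bijective from `(ker A)ᗮ` onto `E`, and the inverse is bounded by the open mapping
theorem. -/
theorem exists_rightInverse_of_surjective {E : Type*} [NormedAddCommGroup E]
    [InnerProductSpace ℂ E] [CompleteSpace E] {A : E →L[ℂ] E} (hA : Function.Surjective A) :
    ∃ S : E →L[ℂ] E, A * S = 1 := by
  let K := LinearMap.ker (A : E →ₗ[ℂ] E)
  have : CompleteSpace K := A.isClosed_ker.completeSpace_coe
  let B := A.comp Kᗮ.subtypeL
  have hinj : Function.Injective B := by
    rw [injective_iff_map_eq_zero]
    intro x hx
    have hK : (x : E) ∈ K := hx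
    exact Subtype.ext (inner_self_eq_zero.1 (x.2 x hK))
  have hsurj : Function.Surjective B := by
    intro y
    obtain ⟨x, rfl⟩ := hA y
    obtain ⟨u, hu, v, hv, rfl⟩ := K.exists_add_mem_mem_orthogonal x
    refine ⟨⟨v, hv⟩, ?_⟩
    have : A u = 0 := hu
    simp [B, this]
  let B' := ContinuousLinearEquiv.ofBijective B (LinearMap.ker_eq_bot.2 hinj)
    (LinearMap.range_eq_top.2 hsurj)
  refine ⟨Kᗮ.subtypeL.comp (B'.symm : E →L[ℂ] Kᗮ), ?_⟩
  ext x
  exact B'.apply_symm_apply x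

theorem surjective_sub_smul {T : H →L[ℍᵐᵒᵖ] H} {ω : ℂ}
    (h : Function.Surjective (sPoly T (ω : ℍ))) :
    Function.Surjective (toComplex T - ω • ContinuousLinearMap.id ℂ H) := by
  intro y
  obtain ⟨x, rfl⟩ := h y
  refine ⟨T x - starRingEnd ℂ ω • x, ?_⟩
  rw [sPoly_coe_apply]
  simp only [sub_apply, toComplex_apply, smul_apply,
    ContinuousLinearMap.id_apply, map_sub, map_complex_smul]
  module

/-- If `(T - ω₀) S = 1` and `P ω = 1 - (ω - ω₀) S`, then `T - ω = (T - ω₀) P ω`. So where `P ω` is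
invertible, its inverse carries `ker (T - ω₀)` onto `ker (T - ω)`, holomorphically in `ω`. -/
theorem exists_local_frame [CompleteSpace H] {T : H →L[ℍᵐᵒᵖ] H} {ω₀ : ℂ}
    {n : ℕ} (hsurj : Function.Surjective (sPoly T (ω₀ : ℍ))) {e : Fin n → H}
    (he : LinearIndependent ℂ e) (hspan : Submodule.span ℂ (Set.range e) = eigenspace T ω₀) :
    ∃ Δ : Set ℂ, IsOpen Δ ∧ ω₀ ∈ Δ ∧ ∃ γ : Fin n → ℂ → H,
      (∀ i, DifferentiableOn ℂ (γ i) Δ) ∧ ∀ ω ∈ Δ, LinearIndependent ℂ (fun i => γ i ω) ∧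
        Submodule.span ℂ (Set.range fun i => γ i ω) = eigenspace T ω := by
  obtain ⟨S, hS⟩ := exists_rightInverse_of_surjective (surjective_sub_smul hsurj)
  let P : ℂ → H →L[ℂ] H := fun ω => 1 - (ω - ω₀) • S
  have hP : Differentiable ℂ P := by fun_prop
  refine ⟨P ⁻¹' {a | IsUnit a}, Units.isOpen.preimage hP.continuous, by simp [P],
    fun i ω => Ring.inverse (P ω) (e i), fun i ω hω => ?_, fun ω hω => ?_⟩
  · have h1 : DifferentiableAt ℂ (Ring.inverse : (H →L[ℂ] H) → _) (P ω) :=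
      differentiableAt_inverse hω
    exact ((h1.comp ω (hP ω)).clm_apply (differentiableAt_const (e i))).differentiableWithinAt
  · have hPR : ∀ x, P ω (Ring.inverse (P ω) x) = x := fun x =>
      congrArg (fun A : H →L[ℂ] H => A x) (Ring.mul_inverse_cancel (P ω) hω)
    have hRP : ∀ x, Ring.inverse (P ω) (P ω x) = x := fun x =>
      congrArg (fun A : H →L[ℂ] H => A x) (Ring.inverse_mul_cancel (P ω) hω)
    have hfac : ∀ x, T x - ω • x = T (P ω x) - ω₀ • P ω x := by
      intro x
      have h1 : T (S x) - ω₀ • S x = x := congrArg (fun A : H →L[ℂ] H => A x) hS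
      have h2 : T (S x) = ω₀ • S x + x := by rw [← sub_eq_iff_eq_add', h1]
      have h3 : P ω x = x - (ω - ω₀) • S x := rfl
      rw [h3, map_sub, map_complex_smul, h2]
      module
    let R : H →ₗ[ℂ] H := (Ring.inverse (P ω) : H →L[ℂ] H)
    refine ⟨he.map' R (LinearMap.ker_eq_bot.2 (Function.LeftInverse.injective hPR)), ?_⟩
    have hr : Set.range (fun i => Ring.inverse (P ω) (e i)) = R '' Set.range e := by
      rw [← Set.range_comp]
      rfl
    rw [hr, ← Submodule.map_span, hspan]
    ext x
    rw [Submodule.mem_map]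
    constructor
    · rintro ⟨y, hy, rfl⟩
      rw [mem_eigenspace, ← sub_eq_zero] at hy ⊢
      rw [hfac]
      simpa only [R, ContinuousLinearMap.coe_coe, hPR] using hy
    · intro hx
      refine ⟨P ω x, ?_, hRP x⟩
      rw [mem_eigenspace, ← sub_eq_zero] at hx ⊢
      rwa [← hfac]

/-- The coefficients of `Q_z(T)` involve `z̄` while `γ` is holomorphic, so `Q_z(T) γ(z) = 0` yields
different equations when differentiated in the directions `1` and `i`. Eliminating `Q_ω(T) γ'(ω)`
leaves `T γ(ω) = ω γ(ω)`. -/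
theorem mem_eigenspace_of_differentiableAt {T : H →L[ℍᵐᵒᵖ] H} {γ : ℂ → H} {ω : ℂ}
    (hγ : DifferentiableAt ℂ γ ω) (hmem : ∀ᶠ z in 𝓝 ω, γ z ∈ kernelCurve T z) :
    γ ω ∈ eigenspace T ω := by
  have h0 := hγ.hasDerivAt
  have h1 : HasDerivAt (fun z => T (γ z)) (T (deriv γ ω)) ω :=
    (toComplex T).hasFDerivAt.comp_hasDerivAt ω h0
  have h2 : HasDerivAt (fun z => T (T (γ z))) (T (T (deriv γ ω))) ω :=
    (toComplex T).hasFDerivAt.comp_hasDerivAt ω h1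
  have key : ∀ v : ℂ, v • (T (T (deriv γ ω)) - (ω + starRingEnd ℂ ω) • T (deriv γ ω) +
      (ω * starRingEnd ℂ ω) • deriv γ ω) - (v + starRingEnd ℂ v) • T (γ ω) +
      (v * starRingEnd ℂ ω + ω * starRingEnd ℂ v) • γ ω = 0 := by
    intro v
    -- Conjugation is only real differentiable, hence the restriction to a real line with direction
    -- `v`.
    let ℓ : ℝ → ℂ := fun t => ω + t * v
    have hℓ0 : ℓ 0 = ω := by simp [ℓ]
    have hmul : HasDerivAt (fun t : ℝ => (t : ℂ) * v) v 0 := by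
      simpa using (Complex.ofRealCLM.hasDerivAt (x := (0 : ℝ))).mul_const v
    have hℓ : HasDerivAt ℓ v 0 := hmul.const_add ω
    have hℓ' : HasDerivAt (fun t => starRingEnd ℂ (ℓ t)) (starRingEnd ℂ v) 0 := hℓ.star
    have g0 := h0.scomp_of_eq (0 : ℝ) hℓ hℓ0.symm
    have g1 := h1.scomp_of_eq (0 : ℝ) hℓ hℓ0.symm
    have g2 := h2.scomp_of_eq (0 : ℝ) hℓ hℓ0.symm
    have g := (g2.sub ((hℓ.add hℓ').smul g1)).add ((hℓ.mul hℓ').smul g0)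
    have hzero : ∀ᶠ t in 𝓝 (0 : ℝ), T (T (γ (ℓ t))) - (ℓ t + starRingEnd ℂ (ℓ t)) • T (γ (ℓ t)) +
        (ℓ t * starRingEnd ℂ (ℓ t)) • γ (ℓ t) = 0 := by
      have := hℓ.continuousAt.tendsto
      rw [hℓ0] at this
      filter_upwards [this.eventually hmem] with t ht using mem_kernelCurve.1 ht
    have := (g.congr_of_eventuallyEq (f₁ := fun _ => (0 : H)) ?_).unique (hasDerivAt_const _ _)
    · rw [← this]
      simp only [Function.comp_apply, Pi.add_apply, Pi.mul_apply, hℓ0]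
      module
    · filter_upwards [hzero] with t ht using ht.symm
  have k1 := key 1
  have kI := key Complex.I
  rw [mem_eigenspace]
  generalize T (T (deriv γ ω)) - (ω + starRingEnd ℂ ω) • T (deriv γ ω) +
      (ω * starRingEnd ℂ ω) • deriv γ ω = q at k1 kI
  simp only [map_one, Complex.conj_I, add_neg_cancel, zero_smul, sub_zero] at k1 kI
  have kI' : q = (ω - starRingEnd ℂ ω) • γ ω := by
    have h3 : Complex.I • (q - (ω - starRingEnd ℂ ω) • γ ω) = 0 := by
      rw [← kI]
      module
    exact sub_eq_zero.1 ((smul_eq_zero.1 h3).resolve_left Complex.I_ne_zero)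
  have h4 : (2 : ℂ) • (T (γ ω) - ω • γ ω) = 0 := by
    rw [← neg_eq_zero, ← k1, kI']
    module
  exact sub_eq_zero.1 ((smul_eq_zero.1 h4).resolve_left two_ne_zero)

end Frames

/-! ### The reduced set, and transfer of the Cowen–Douglas conditions to it. -/

section Reduced

theorem continuous_reduction : Continuous fun ω : ℍ => (⟨ω.re, ‖ω.im‖⟩ : ℂ) := by
  have : (fun ω : ℍ => (⟨ω.re, ‖ω.im‖⟩ : ℂ)) = fun ω : ℍ => (ω.re : ℂ) + (‖ω.im‖ : ℂ) * Complex.I := by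
    funext ω
    exact Complex.mk_eq_add_mul_I _ _
  rw [this]
  have h1 : Continuous fun ω : ℍ => ω.re := Quaternion.continuous_re
  have h2 : Continuous fun ω : ℍ => ω.im := Quaternion.continuous_im
  fun_prop

theorem norm_im_ne_zero {Ωq : Set ℍ} (hreal : ∀ r : ℝ, (r : ℍ) ∉ Ωq) {ω : ℍ} (hω : ω ∈ Ωq) :
    ‖ω.im‖ ≠ 0 := by
  intro h
  apply hreal ω.re
  rw [norm_eq_zero] at h
  have := ω.re_add_im
  rw [h, add_zero] at this
  rwa [this]

theorem im_pos_of_mem_reducedSet {Ωq : Set ℍ} (hreal : ∀ r : ℝ, (r : ℍ) ∉ Ωq) {z : ℂ}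
    (hz : z ∈ reducedSet Ωq) : 0 < z.im := by
  obtain ⟨ω, hω, rfl⟩ := hz
  exact (norm_nonneg _).lt_of_ne' (norm_im_ne_zero hreal hω)

theorem isOpen_reducedSet {Ωq : Set ℍ} (hopen : IsOpen Ωq) (hreal : ∀ r : ℝ, (r : ℍ) ∉ Ωq) :
    IsOpen (reducedSet Ωq) := by
  rw [isOpen_iff_mem_nhds]
  rintro _ ⟨ω, hω, rfl⟩
  have hne := norm_im_ne_zero hreal hω
  -- A continuous local section of the reduction map through `ω`, obtained by keeping the direction
  -- of `ω.im`.
  let s : ℂ → ℍ := fun z => (z.re : ℍ) + (z.im / ‖ω.im‖) • ω.im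
  have hs : Continuous s := by
    have : Continuous fun z : ℂ => ((z.re : ℝ) : ℍ) :=
      Quaternion.continuous_coe.comp Complex.continuous_re
    have := Complex.continuous_im
    fun_prop
  have hs0 : s ⟨ω.re, ‖ω.im‖⟩ = ω := by
    simp only [s, div_self hne, one_smul, Quaternion.re_add_im]
  have h1 : ∀ᶠ z in 𝓝 (⟨ω.re, ‖ω.im‖⟩ : ℂ), s z ∈ Ωq :=
    hs.continuousAt.eventually_mem (hs0.symm ▸ hopen.mem_nhds hω)
  have h2 : ∀ᶠ z in 𝓝 (⟨ω.re, ‖ω.im‖⟩ : ℂ), 0 < z.im :=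
    Complex.continuous_im.continuousAt.eventually_mem
      (isOpen_Ioi.mem_nhds ((norm_nonneg _).lt_of_ne' hne))
  filter_upwards [h1, h2] with z hz hz'
  refine ⟨s z, hz, ?_⟩
  have him : (s z).im = (z.im / ‖ω.im‖) • ω.im := by
    ext <;> simp [s]
  have hre : (s z).re = z.re := by simp [s]
  apply Complex.ext
  · exact hre
  · change ‖(s z).im‖ = z.im
    rw [him, norm_smul, Real.norm_of_nonneg (by positivity), div_mul_cancel₀ _ hne]

theorem isPreconnected_reducedSet {Ωq : Set ℍ} (hconn : IsConnected Ωq) :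
    IsPreconnected (reducedSet Ωq) :=
  hconn.isPreconnected.image _ continuous_reduction.continuousOn

variable {H : Type*} [NormedAddCommGroup H] [Module ℍᵐᵒᵖ H] [QuaternionicInnerProductSpace H]

theorem sPoly_reduction (T : H →L[ℍᵐᵒᵖ] H) (ω : ℍ) :
    sPoly T (((⟨ω.re, ‖ω.im‖⟩ : ℂ) : ℍ)) = sPoly T ω := by
  refine sPoly_eq_of_re_norm T rfl ?_
  rw [norm_coeComplex]
  refine (sq_eq_sq₀ (norm_nonneg _) (norm_nonneg _)).1 ?_
  rw [Complex.sq_norm, Complex.normSq_apply, sq, ← Quaternion.normSq_eq_norm_mul_self,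
    ← Quaternion.normSq_eq_norm_mul_self, Quaternion.normSq_def', Quaternion.normSq_def']
  simp
  ring

theorem kernelCurve_reduction (T : H →L[ℍᵐᵒᵖ] H) (ω : ℍ) :
    kernelCurve T ⟨ω.re, ‖ω.im‖⟩ = sKer T ω := by
  rw [kernelCurve, sKer, sPoly_reduction, sKer]

namespace IsCowenDouglas

variable {n : ℕ} {Ωq : Set ℍ} {T : H →L[ℍᵐᵒᵖ] H}

theorem surjective_sPoly (hT : IsCowenDouglas n Ωq T) {z : ℂ} (hz : z ∈ reducedSet Ωq) :
    Function.Surjective (sPoly T (z : ℍ)) := by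
  obtain ⟨ω, hω, rfl⟩ := hz
  rw [sPoly_reduction]
  exact Set.range_eq_univ.1 (hT.range_eq ω hω)

theorem rank_kernelCurve (hT : IsCowenDouglas n Ωq T) {z : ℂ} (hz : z ∈ reducedSet Ωq) :
    Module.rank ℍᵐᵒᵖ (kernelCurve T z) = n := by
  obtain ⟨ω, hω, rfl⟩ := hz
  rw [kernelCurve_reduction]
  exact hT.rank_eq ω hω

theorem dense_span_kernelCurve (hT : IsCowenDouglas n Ωq T) :
    Dense (Submodule.span ℍᵐᵒᵖ (⋃ z : reducedSet Ωq, (kernelCurve T z : Set H)) : Set H) := by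
  rw [dense_iff_closure_eq, ← Set.univ_subset_iff, ← hT.dense_span]
  refine closure_mono (Submodule.span_mono (Set.iUnion₂_subset fun ω hω => ?_))
  rw [← kernelCurve_reduction]
  exact Set.subset_iUnion (fun z : reducedSet Ωq => (kernelCurve T z : Set H)) ⟨_, ω, hω, rfl⟩

theorem isRightHolomorphicCurve [CompleteSpace H] (hT : IsCowenDouglas n Ωq T)
    (hopen : IsOpen Ωq) (hreal : ∀ r : ℝ, (r : ℍ) ∉ Ωq) :
    IsRightHolomorphicCurve n (reducedSet Ωq) (kernelCurve T) := by
  intro ω₀ hω₀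
  obtain ⟨e, he, hspan⟩ := exists_eigenspace_basis (im_pos_of_mem_reducedSet hreal hω₀).ne'
    (hT.rank_kernelCurve hω₀)
  obtain ⟨Δ, hΔ, hmem, γ, hγ, hb⟩ := exists_local_frame (hT.surjective_sPoly hω₀) he hspan
  have hΔ' := hΔ.inter (isOpen_reducedSet hopen hreal)
  refine ⟨Δ ∩ reducedSet Ωq, hΔ', ⟨hmem, hω₀⟩, Set.inter_subset_right, γ, fun i => ?_,
    fun ω hω => ?_⟩
  · exact (rightHolomorphicOn_iff hΔ').2 ((hγ i).mono Set.inter_subset_left)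
  · have him := (im_pos_of_mem_reducedSet hreal hω.2).ne'
    obtain ⟨h1, h2⟩ := hb ω hω.1
    have hmem : ∀ i, γ i ω ∈ eigenspace T ω := fun i => h2 ▸ Submodule.subset_span ⟨i, rfl⟩
    exact ⟨linearIndependent_of_eigenspace him h1 hmem, span_eq_kernelCurve him h2⟩

end IsCowenDouglas

end Reduced

/-! ### Unitary equivalence implies bundle equivalence. -/

section Forward

variable {H : Type*} [NormedAddCommGroup H] [Module ℍᵐᵒᵖ H] [QuaternionicInnerProductSpace H]

theorem mapSection_apply {H : Type*} [NormedAddCommGroup H] [Module ℍᵐᵒᵖ H] {Ω : Set ℂ} {t₁ t₂ : ℂ → Submodule ℍᵐᵒᵖ H}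
    (Φ : ∀ ω : Ω, t₁ ω ≃ₗ[ℍᵐᵒᵖ] t₂ ω) {γ : ℂ → H} {ω : ℂ} (hω : ω ∈ Ω) (hγ : γ ω ∈ t₁ ω) :
    mapSection Φ γ ω = Φ ⟨ω, hω⟩ ⟨γ ω, hγ⟩ :=
  dif_pos ⟨hω, hγ⟩

theorem iteratedDeriv_continuousLinearMap_comp [CompleteSpace H] (L : H →L[ℂ] H) {f : ℂ → H}
    {Δ : Set ℂ} (hΔ : IsOpen Δ) (hf : DifferentiableOn ℂ f Δ) {z : ℂ} (hz : z ∈ Δ) (m : ℕ) :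
    iteratedDeriv m (fun x => L (f x)) z = L (iteratedDeriv m f z) := by
  have hc : ContDiffAt ℂ m f z := ((hf.contDiffOn hΔ).contDiffAt (hΔ.mem_nhds hz))
  rw [iteratedDeriv_eq_iteratedFDeriv, iteratedDeriv_eq_iteratedFDeriv]
  change iteratedFDeriv ℂ m (L ∘ f) z _ = _
  rw [L.iteratedFDeriv_comp_left hc le_rfl]
  rfl

theorem sPoly_intertwine {Q T₁ T₂ : H →L[ℍᵐᵒᵖ] H} (h : Q * T₁ = T₂ * Q) (s : ℍ) (x : H) :
    Q (sPoly T₁ s x) = sPoly T₂ s (Q x) := by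
  have h' : ∀ x, Q (T₁ x) = T₂ (Q x) := fun x => congrArg (fun A : H →L[ℍᵐᵒᵖ] H => A x) h
  rw [sPoly_apply, sPoly_apply, map_add, map_sub, map_complex_smul, map_complex_smul, h', h']

theorem UnitarilyEquivalent.bundleEquivalent [CompleteSpace H] {T₁ T₂ : H →L[ℍᵐᵒᵖ] H}
    (h : UnitarilyEquivalent T₁ T₂) (Ω : Set ℂ) :
    BundleEquivalent Ω (kernelCurve T₁) (kernelCurve T₂) := by
  obtain ⟨Q, ⟨S, hadj, hSQ, hQS⟩, hQ⟩ := h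
  have hSQ' : ∀ x, S (Q x) = x := fun x => congrArg (fun A : H →L[ℍᵐᵒᵖ] H => A x) hSQ
  have hQS' : ∀ x, Q (S x) = x := fun x => congrArg (fun A : H →L[ℍᵐᵒᵖ] H => A x) hQS
  have hinner : ∀ x y : H, qinner (Q x) (Q y) = qinner x y := fun x y => by rw [hadj, hSQ']
  let E : H ≃ₗ[ℍᵐᵒᵖ] H := { (Q : H →ₗ[ℍᵐᵒᵖ] H) with
    invFun := S
    left_inv := hSQ'
    right_inv := hQS' }
  have hE : ∀ ω, (kernelCurve T₁ ω).map (E : H →ₗ[ℍᵐᵒᵖ] H) = kernelCurve T₂ ω := by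
    intro ω
    ext y
    rw [Submodule.mem_map]
    constructor
    · rintro ⟨x, hx, rfl⟩
      change sPoly T₂ _ (Q x) = 0
      have hx' : sPoly T₁ (ω : ℍ) x = 0 := hx
      rw [← sPoly_intertwine hQ, hx', map_zero]
    · intro hy
      refine ⟨S y, ?_, hQS' y⟩
      have hy' : sPoly T₂ (ω : ℍ) y = 0 := hy
      change sPoly T₁ (ω : ℍ) (S y) = 0
      rw [← hSQ' (sPoly T₁ (ω : ℍ) (S y)), sPoly_intertwine hQ, hQS', hy', map_zero]
  let Φ : ∀ ω : Ω, kernelCurve T₁ ω ≃ₗ[ℍᵐᵒᵖ] kernelCurve T₂ ω := fun ω =>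
    E.ofSubmodules _ _ (hE ω)
  have hΦ : ∀ {Δ : Set ℂ} {γ : ℂ → H}, Δ ⊆ Ω → IsRightHolomorphicSection (kernelCurve T₁) Δ γ →
      ∀ ω ∈ Δ, mapSection Φ γ ω = Q (γ ω) := fun hΔΩ hγ ω hω =>
    mapSection_apply Φ (hΔΩ hω) (hγ.mem ω hω)
  refine ⟨Φ, fun Δ γ hΔ hΔΩ hγ => ⟨?_, fun ω hω => ?_⟩,
    fun Δ γ γ' hΔ hΔΩ hγ hγ' m ω hω => ?_⟩
  · rw [rightHolomorphicOn_iff hΔ]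
    exact ((toComplex Q).differentiable.comp_differentiableOn
      ((rightHolomorphicOn_iff hΔ).1 hγ.holomorphic)).congr (hΦ hΔΩ hγ)
  · rw [mapSection_apply Φ (hΔΩ hω) (hγ.mem ω hω)]
    exact Subtype.property _
  · have heq : mapSection Φ γ =ᶠ[𝓝 ω] fun z => toComplex Q (γ z) := by
      filter_upwards [hΔ.mem_nhds hω] with z hz using hΦ hΔΩ hγ z hz
    rw [iteratedRightDeriv_eq, iteratedRightDeriv_eq, heq.iteratedDeriv_eq,
      iteratedDeriv_continuousLinearMap_comp _ hΔ ((rightHolomorphicOn_iff hΔ).1 hγ.holomorphic) hω,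
      hΦ hΔΩ hγ' ω hω, toComplex_apply, hinner]

end Forward

/-! ### Bundle equivalence implies unitary equivalence. -/

section Rigidity

variable {H : Type*} [NormedAddCommGroup H] [Module ℍᵐᵒᵖ H] [QuaternionicInnerProductSpace H]
  {n : ℕ} {Ω : Set ℂ} {t₁ t₂ : ℂ → Submodule ℍᵐᵒᵖ H}

/-- `Φ z` and `Φ w` preserve the inner products between the fibres over `z` and `w`. -/
def PreservesInner (Φ : ∀ ω : Ω, t₁ ω ≃ₗ[ℍᵐᵒᵖ] t₂ ω) (z w : Ω) : Prop :=
  ∀ (x : t₁ z) (y : t₁ w), qinner (x : H) (y : H) = qinner (Φ z x : H) (Φ w y : H)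

/-- The frame sits in the linear slot of the complex inner product, so for holomorphic `γ i` and
`mapSection Φ (γ i)` both sides of the criterion are holomorphic in `z`. -/
theorem preservesInner_iff (Φ : ∀ ω : Ω, t₁ ω ≃ₗ[ℍᵐᵒᵖ] t₂ ω) (z w : Ω) {γ : Fin n → ℂ → H}
    (hγ : Submodule.span ℍᵐᵒᵖ (Set.range fun i => γ i z) = t₁ z) :
    PreservesInner Φ z w ↔ ∀ i, ∀ y : t₁ w,
      inner ℂ (y : H) (γ i z) = inner ℂ (Φ w y : H) (mapSection Φ (γ i) z) := by
  have hmem : ∀ i, γ i z ∈ t₁ z := fun i => hγ ▸ Submodule.subset_span ⟨i, rfl⟩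
  have hmap : ∀ i, mapSection Φ (γ i) z = Φ z ⟨γ i z, hmem i⟩ := fun i =>
    mapSection_apply Φ z.2 (hmem i)
  refine ⟨fun h i y => ?_, fun h x y => ?_⟩
  · rw [inner_eq_complexPart, inner_eq_complexPart, hmap]
    exact congrArg complexPart (h ⟨γ i z, hmem i⟩ y)
  · have hframe : ∀ i, qinner (γ i z) (y : H) = qinner (mapSection Φ (γ i) z) (Φ w y : H) := by
      intro i
      refine eq_of_complexPart_eq (h i y) ?_
      rw [← qinner_smul_right, ← qinner_smul_right, ← Submodule.coe_smul, ← Submodule.coe_smul,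
        ← map_smul]
      exact h i (y <• quatJ)
    obtain ⟨c, hc⟩ := (Submodule.mem_span_range_iff_exists_fun ℍᵐᵒᵖ).1 (hγ.symm ▸ x.2 :
      (x : H) ∈ Submodule.span ℍᵐᵒᵖ (Set.range fun i => γ i z))
    have hx : x = ∑ i, c i • (⟨γ i z, hmem i⟩ : t₁ z) := by
      apply Subtype.ext
      rw [← hc, Submodule.coe_sum]
      rfl
    have hΦx : (Φ z x : H) = ∑ i, c i • mapSection Φ (γ i) z := by
      rw [hx, map_sum, Submodule.coe_sum]
      exact Finset.sum_congr rfl fun i _ => by rw [map_smul, Submodule.coe_smul, hmap]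
    rw [← hc, hΦx, qinner_sum_left, qinner_sum_left]
    refine Finset.sum_congr rfl fun i _ => ?_
    rw [← MulOpposite.op_unop (c i), qinner_smul_left, qinner_smul_left, hframe]

theorem inner_eq_on_ball [CompleteSpace H] {γ δ : ℂ → H} {w : ℂ} {r : ℝ}
    (hγ : DifferentiableOn ℂ γ (Metric.ball w r)) (hδ : DifferentiableOn ℂ δ (Metric.ball w r))
    {y y' : H}
    (h : ∀ m, inner ℂ y (iteratedDeriv m γ w) = inner ℂ y' (iteratedDeriv m δ w))
    {z : ℂ} (hz : z ∈ Metric.ball w r) : inner ℂ y (γ z) = inner ℂ y' (δ z) := by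
  have h1 := (innerSL ℂ y).hasSum (Complex.hasSum_taylorSeries_on_ball hγ hz)
  have h2 := (innerSL ℂ y').hasSum (Complex.hasSum_taylorSeries_on_ball hδ hz)
  simp only [map_smul, innerSL_apply_apply] at h1 h2
  simp only [h] at h1
  exact h1.unique h2

theorem preservesInner_of_curve [CompleteSpace H] (hpre : IsPreconnected Ω)
    (hcurve : IsRightHolomorphicCurve n Ω t₁)
    (Φ : ∀ ω : Ω, t₁ ω ≃ₗ[ℍᵐᵒᵖ] t₂ ω)
    (hsec : ∀ (Δ : Set ℂ) (γ : ℂ → H), IsOpen Δ → Δ ⊆ Ω → IsRightHolomorphicSection t₁ Δ γ →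
      IsRightHolomorphicSection t₂ Δ (mapSection Φ γ))
    (hinner : ∀ (Δ : Set ℂ) (γ γ' : ℂ → H), IsOpen Δ → Δ ⊆ Ω →
      IsRightHolomorphicSection t₁ Δ γ → IsRightHolomorphicSection t₁ Δ γ' →
      ∀ (m : ℕ), ∀ ω ∈ Δ, qinner (iteratedRightDeriv m γ ω) (γ' ω) =
          qinner (iteratedRightDeriv m (mapSection Φ γ) ω) (mapSection Φ γ' ω))
    (z w : Ω) : PreservesInner Φ z w := by
  -- With `w` fixed, `interior G` contains `w` and is relatively closed in the preconnected set `Ω`.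
  -- Points outside `Ω` belong to `G` vacuously, which does no harm.
  let G : Set ℂ := {z | ∀ hz : z ∈ Ω, PreservesInner Φ ⟨z, hz⟩ w}
  have hframe : ∀ ω₀ ∈ Ω, ∃ r > 0, Metric.ball ω₀ r ⊆ Ω ∧ ∃ γ : Fin n → ℂ → H,
      (∀ i, IsRightHolomorphicSection t₁ (Metric.ball ω₀ r) (γ i)) ∧
      (∀ i, DifferentiableOn ℂ (γ i) (Metric.ball ω₀ r)) ∧
      (∀ i, DifferentiableOn ℂ (mapSection Φ (γ i)) (Metric.ball ω₀ r)) ∧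
      ∀ ω ∈ Metric.ball ω₀ r, Submodule.span ℍᵐᵒᵖ (Set.range fun i => γ i ω) = t₁ ω := by
    intro ω₀ hω₀
    obtain ⟨Δ, hΔ, hmem, hΔΩ, γ, hγ, hb⟩ := hcurve ω₀ hω₀
    obtain ⟨r, hr, hball⟩ := Metric.isOpen_iff.1 hΔ ω₀ hmem
    have hs : ∀ i, IsRightHolomorphicSection t₁ (Metric.ball ω₀ r) (γ i) := fun i =>
      ⟨fun z hz => hγ i z (hball hz), fun z hz =>
        (hb z (hball hz)).2 ▸ Submodule.subset_span ⟨i, rfl⟩⟩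
    exact ⟨r, hr, hball.trans hΔΩ, γ, hs,
      fun i => (rightHolomorphicOn_iff Metric.isOpen_ball).1 (hs i).holomorphic,
      fun i => (rightHolomorphicOn_iff Metric.isOpen_ball).1
        (hsec _ _ Metric.isOpen_ball (hball.trans hΔΩ) (hs i)).holomorphic,
      fun ω hω => (hb ω (hball hω)).2⟩
  -- The derivative condition at `w`, tested against the frame, matches all Taylor coefficients
  -- there.
  have hw : (w : ℂ) ∈ interior G := by
    obtain ⟨r, hr, hsub, γ, hs, hd, hd', hspan⟩ := hframe w w.2
    have hww := Metric.mem_ball_self (x := (w : ℂ)) hr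
    have hmem : ∀ i, γ i w ∈ t₁ w := fun i => (hs i).mem w hww
    refine mem_interior.2 ⟨_, fun z hz hzΩ => ?_, Metric.isOpen_ball, hww⟩
    rw [preservesInner_iff Φ ⟨z, hzΩ⟩ w (hspan z hz)]
    refine fun i y => inner_eq_on_ball (hd i) (hd' i) (fun m => ?_) hz
    obtain ⟨c, hc⟩ := (Submodule.mem_span_range_iff_exists_fun ℍᵐᵒᵖ).1 ((hspan w hww).symm ▸ y.2 :
      (y : H) ∈ Submodule.span ℍᵐᵒᵖ (Set.range fun i => γ i w))
    have hy : y = ∑ j, c j • (⟨γ j w, hmem j⟩ : t₁ w) := by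
      apply Subtype.ext
      rw [← hc, Submodule.coe_sum]
      rfl
    have hΦy : (Φ w y : H) = ∑ j, c j • mapSection Φ (γ j) w := by
      rw [hy, map_sum, Submodule.coe_sum]
      exact Finset.sum_congr rfl fun j _ => by
        rw [map_smul, Submodule.coe_smul, mapSection_apply Φ w.2 (hmem j)]
    rw [inner_eq_complexPart, inner_eq_complexPart, ← hc, hΦy, qinner_sum_right, qinner_sum_right]
    refine congrArg complexPart (Finset.sum_congr rfl fun j _ => ?_)
    have := hinner _ _ _ Metric.isOpen_ball hsub (hs i) (hs j) m w hww
    rw [iteratedRightDeriv_eq, iteratedRightDeriv_eq] at this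
    rw [← MulOpposite.op_unop (c j), qinner_smul_right, qinner_smul_right, this]
  -- A frame ball around a limit point meets `interior G`; the identity theorem spreads the equality
  -- over the ball.
  have hclosed : closure (interior G) ∩ Ω ⊆ interior G := by
    rintro ω₀ ⟨hcl, hω₀⟩
    obtain ⟨r, hr, hsub, γ, hs, hd, hd', hspan⟩ := hframe ω₀ hω₀
    obtain ⟨z₁, hz₁, hz₁G⟩ := mem_closure_iff.1 hcl _ Metric.isOpen_ball (Metric.mem_ball_self hr)
    refine mem_interior.2 ⟨_, fun z hz hzΩ => ?_, Metric.isOpen_ball, Metric.mem_ball_self hr⟩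
    rw [preservesInner_iff Φ ⟨z, hzΩ⟩ w (hspan z hz)]
    intro i y
    refine AnalyticOnNhd.eqOn_of_preconnected_of_eventuallyEq
      (f := fun z => inner ℂ (y : H) (γ i z))
      (g := fun z => inner ℂ (Φ w y : H) (mapSection Φ (γ i) z))
      (((innerSL ℂ (y : H)).differentiable.comp_differentiableOn (hd i)).analyticOnNhd
        Metric.isOpen_ball)
      (((innerSL ℂ (Φ w y : H)).differentiable.comp_differentiableOn (hd' i)).analyticOnNhd
        Metric.isOpen_ball)
      (convex_ball ω₀ r).isPreconnected hz₁ ?_ hz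
    filter_upwards [Metric.isOpen_ball.mem_nhds hz₁, isOpen_interior.mem_nhds hz₁G] with x hx hxG
    exact (preservesInner_iff Φ ⟨x, hsub hx⟩ w (hspan x hx)).1 (interior_subset hxG _) i y
  exact interior_subset (hpre.subset_of_closure_inter_subset isOpen_interior ⟨w, w.2, hw⟩
    hclosed z.2) z.2

/-- The maps `e₁`, `e₂` need not be injective: equality of norms makes `e₁ u ↦ e₂ (F u)` well
defined and isometric. Polarization gives the complex inner product on all of `H`, and testing
against `y j` the quaternionic one. -/
theorem exists_unitary_extension [CompleteSpace H] {E E' : Type*} [AddCommMonoid E]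
    [AddCommMonoid E'] [Module ℍᵐᵒᵖ E] [Module ℍᵐᵒᵖ E'] (F : E ≃ₗ[ℍᵐᵒᵖ] E') {e₁ : E →ₗ[ℍᵐᵒᵖ] H}
    {e₂ : E' →ₗ[ℍᵐᵒᵖ] H} (hd₁ : DenseRange e₁) (hd₂ : DenseRange e₂)
    (hinner : ∀ u v, qinner (e₂ (F u)) (e₂ (F v)) = qinner (e₁ u) (e₁ v)) :
    ∃ Q : H →L[ℍᵐᵒᵖ] H, IsQuaternionicUnitary Q ∧ ∀ u, Q (e₁ u) = e₂ (F u) := by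
  let _ : NormedDivisionRing ℍᵐᵒᵖ := normedDivisionRingOpposite
  have : IsBoundedSMul ℍᵐᵒᵖ H := isBoundedSMul H
  let _ : AddCommGroup E := Module.addCommMonoidToAddCommGroup ℍᵐᵒᵖ
  let _ : AddCommGroup E' := Module.addCommMonoidToAddCommGroup ℍᵐᵒᵖ
  have hnorm : ∀ u, ‖e₂ (F u)‖ = ‖e₁ u‖ := by
    intro u
    have := hinner u u
    rw [qinner_self, qinner_self] at this
    exact (sq_eq_sq₀ (norm_nonneg _) (norm_nonneg _)).1 (Quaternion.coe_injective this)
  let U : H ≃L[ℍᵐᵒᵖ] H := F.extend e₁ e₂ hd₁ ⟨1, fun u => by rw [hnorm, one_mul]⟩ hd₂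
    ⟨1, fun u => by rw [← hnorm, LinearEquiv.apply_symm_apply, one_mul]⟩
  have hU : ∀ u, U (e₁ u) = e₂ (F u) := fun u => LinearEquiv.extend_eq _ _ _ _ _ _ _ u
  have hUnorm : ∀ x, ‖U x‖ = ‖x‖ := by
    refine hd₁.induction ?_ (isClosed_eq (U.continuous.norm) continuous_norm)
    rintro _ ⟨u, rfl⟩
    rw [hU, hnorm]
  have hUinner : ∀ x y, qinner (U x) (U y) = qinner x y := by
    have hC : ∀ x y, complexPart (qinner (U x) (U y)) = complexPart (qinner x y) := fun x y =>
      LinearIsometry.inner_map_map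
        (⟨(toComplex (U : H →L[ℍᵐᵒᵖ] H) : H →ₗ[ℂ] H), hUnorm⟩ : H →ₗᵢ[ℂ] H) y x
    intro x y
    refine eq_of_complexPart_eq (hC x y) ?_
    rw [← qinner_smul_right, ← qinner_smul_right, ← map_smul]
    exact hC x _
  refine ⟨U, ⟨U.symm, fun x y => ?_, ?_, ?_⟩, hU⟩
  · have h := hUinner x (U.symm y)
    rw [U.apply_symm_apply] at h
    exact h
  · ext x
    exact U.symm_apply_apply x
  · ext x
    exact U.apply_symm_apply x

open Classical in
-- On the external direct sum the fibrewise maps `Φ ω` assemble without any check of relations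
-- between different fibres.
theorem exists_denseRange_dfinsupp {H : Type*} [NormedAddCommGroup H] [Module ℍᵐᵒᵖ H]
    (t : ℂ → Submodule ℍᵐᵒᵖ H)
    (ht : Dense (Submodule.span ℍᵐᵒᵖ (⋃ z : Ω, (t z : Set H)) : Set H)) :
    ∃ e : (Π₀ ω : Ω, t ω) →ₗ[ℍᵐᵒᵖ] H, DenseRange e ∧
      ∀ (ω : Ω) (x : t ω), e (DFinsupp.single ω x) = x := by
  refine ⟨DFinsupp.lsum ℕ fun ω : Ω => (t ω).subtype, ?_,
    fun ω x => DFinsupp.lsum_single ℕ (fun ω : Ω => (t ω).subtype) ω x⟩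
  rw [Submodule.span_iUnion] at ht
  simp only [Submodule.span_eq] at ht
  rw [Submodule.iSup_eq_range_dfinsupp_lsum] at ht
  exact ht

open Classical in
theorem exists_unitary_of_preservesInner [CompleteSpace H] (Φ : ∀ ω : Ω, t₁ ω ≃ₗ[ℍᵐᵒᵖ] t₂ ω)
    (hΦ : ∀ z w, PreservesInner Φ z w)
    (hd₁ : Dense (Submodule.span ℍᵐᵒᵖ (⋃ z : Ω, (t₁ z : Set H)) : Set H))
    (hd₂ : Dense (Submodule.span ℍᵐᵒᵖ (⋃ z : Ω, (t₂ z : Set H)) : Set H)) :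
    ∃ Q : H →L[ℍᵐᵒᵖ] H, IsQuaternionicUnitary Q ∧ ∀ (ω : Ω) (x : t₁ ω), Q x = Φ ω x := by
  obtain ⟨e₁, he₁, hs₁⟩ := exists_denseRange_dfinsupp t₁ hd₁
  obtain ⟨e₂, he₂, hs₂⟩ := exists_denseRange_dfinsupp t₂ hd₂
  obtain ⟨F, hF⟩ : ∃ F : (Π₀ ω : Ω, t₁ ω) ≃ₗ[ℍᵐᵒᵖ] (Π₀ ω : Ω, t₂ ω),
      ∀ (ω : Ω) (x : t₁ ω), F (DFinsupp.single ω x) = DFinsupp.single ω (Φ ω x) :=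
    ⟨DFinsupp.mapRange.linearEquiv Φ, fun ω x =>
      DFinsupp.mapRange_single (hf := fun i => map_zero (Φ i))⟩
  have hinner : ∀ u v, qinner (e₂ (F u)) (e₂ (F v)) = qinner (e₁ u) (e₁ v) := by
    intro u v
    induction u using DFinsupp.induction with
    | h0 => simp only [map_zero, qinner_zero_left]
    | ha z x u _ _ hu =>
      rw [map_add, map_add, map_add, qinner_add_left, qinner_add_left, hu, hF, hs₁, hs₂]
      congr 1
      clear hu
      induction v using DFinsupp.induction with
      | h0 =>
        simp only [map_zero]
        exact ((qinnerRight _).map_zero).trans ((qinnerRight _).map_zero).symm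
      | ha w y v _ _ hv =>
        rw [map_add, map_add, map_add, qinner_add_right, qinner_add_right, hv, hF, hs₁, hs₂,
          ← hΦ z w x y]
  obtain ⟨Q, hQ, hQe⟩ := exists_unitary_extension F he₁ he₂ hinner
  exact ⟨Q, hQ, fun ω x => by rw [← hs₁ ω x, hQe, hF, hs₂]⟩

theorem UnitarilyEquivalent.of_bundleEquivalent [CompleteSpace H] {T₁ T₂ : H →L[ℍᵐᵒᵖ] H}
    (hpre : IsPreconnected Ω) (hcurve : IsRightHolomorphicCurve n Ω (kernelCurve T₁))
    (hd₁ : Dense (Submodule.span ℍᵐᵒᵖ (⋃ z : Ω, (kernelCurve T₁ z : Set H)) : Set H))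
    (hd₂ : Dense (Submodule.span ℍᵐᵒᵖ (⋃ z : Ω, (kernelCurve T₂ z : Set H)) : Set H))
    (h : BundleEquivalent Ω (kernelCurve T₁) (kernelCurve T₂)) : UnitarilyEquivalent T₁ T₂ := by
  obtain ⟨Φ, hsec, hinner⟩ := h
  obtain ⟨Q, hQ, hQΦ⟩ := exists_unitary_of_preservesInner Φ
    (preservesInner_of_curve hpre hcurve Φ hsec hinner) hd₁ hd₂
  refine ⟨Q, hQ, ContinuousLinearMap.ext_on hd₁ fun x hx => ?_⟩
  obtain ⟨ω, hx⟩ := Set.mem_iUnion.1 hx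
  obtain ⟨Δ, hΔ, hmem, hΔΩ, γ, hγ, hb⟩ := hcurve ω ω.2
  have hx' : x ∈ Submodule.span ℍᵐᵒᵖ (Set.range fun i => γ i ω) := (hb ω hmem).2.symm ▸ hx
  refine LinearMap.eqOn_span (f := (Q * T₁ : H →L[ℍᵐᵒᵖ] H).toLinearMap)
    (g := (T₂ * Q : H →L[ℍᵐᵒᵖ] H).toLinearMap) ?_ hx'
  rintro _ ⟨i, rfl⟩
  have hs : IsRightHolomorphicSection (kernelCurve T₁) Δ (γ i) :=
    ⟨hγ i, fun z hz => (hb z hz).2 ▸ Submodule.subset_span ⟨i, rfl⟩⟩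
  -- Applied both to `γ i` and to its image: `Φ` is not assumed to respect eigenspaces, but it
  -- preserves holomorphic sections.
  have heig : ∀ {T : H →L[ℍᵐᵒᵖ] H} {σ : ℂ → H}, IsRightHolomorphicSection (kernelCurve T) Δ σ →
      T (σ ω) = (ω : ℂ) • σ ω := by
    intro T σ hσ
    refine mem_eigenspace.1 (mem_eigenspace_of_differentiableAt
      (((rightHolomorphicOn_iff hΔ).1 hσ.holomorphic).differentiableAt (hΔ.mem_nhds hmem)) ?_)
    filter_upwards [hΔ.mem_nhds hmem] with z hz using hσ.mem z hz
  have hQγ : Q (γ i ω) = mapSection Φ (γ i) ω := by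
    rw [mapSection_apply Φ ω.2 (hs.mem ω hmem)]
    exact hQΦ ω ⟨γ i ω, hs.mem ω hmem⟩
  change Q (T₁ (γ i ω)) = T₂ (Q (γ i ω))
  rw [heig hs, map_complex_smul, hQγ, heig (hsec Δ _ hΔ hΔΩ hs)]

end Rigidity

end QuaternionicHilbert

end

theorem theorem4p2 {H : Type*} [NormedAddCommGroup H] [Module ℍᵐᵒᵖ H]
    [QuaternionicInnerProductSpace H] [CompleteSpace H] [TopologicalSpace.SeparableSpace H]
    (n : ℕ) (hn : 0 < n) (Ωq : Set ℍ) (hopen : IsOpen Ωq) (hconn : IsConnected Ωq)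
    (hreal : ∀ r : ℝ, (r : ℍ) ∉ Ωq) (T₁ T₂ : H →L[ℍᵐᵒᵖ] H)
    (hT₁ : QuaternionicHilbert.IsCowenDouglas n Ωq T₁)
    (hT₂ : QuaternionicHilbert.IsCowenDouglas n Ωq T₂) :
    QuaternionicHilbert.IsRightHolomorphicCurve n (QuaternionicHilbert.reducedSet Ωq)
        (QuaternionicHilbert.kernelCurve T₁) ∧
      QuaternionicHilbert.IsRightHolomorphicCurve n (QuaternionicHilbert.reducedSet Ωq)
        (QuaternionicHilbert.kernelCurve T₂) ∧
      (QuaternionicHilbert.UnitarilyEquivalent T₁ T₂ ↔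
        QuaternionicHilbert.BundleEquivalent (QuaternionicHilbert.reducedSet Ωq)
          (QuaternionicHilbert.kernelCurve T₁) (QuaternionicHilbert.kernelCurve T₂)) :=
  ⟨hT₁.isRightHolomorphicCurve hopen hreal, hT₂.isRightHolomorphicCurve hopen hreal,
    fun h => h.bundleEquivalent _,
    QuaternionicHilbert.UnitarilyEquivalent.of_bundleEquivalent
      (QuaternionicHilbert.isPreconnected_reducedSet hconn)
      (hT₁.isRightHolomorphicCurve hopen hreal) hT₁.dense_span_kernelCurve
      hT₂.dense_span_kernelCurve⟩
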